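/- **Model.** A three-dimensional bit-meters circuit with $n$ inputs and $k$ outputs has computational nodes at the points of $\mathbb{Z}^3$. The $n$ inputs are injected into $n$ distinct input nodes, one per node; each of the $k$ outputs is produced at an output node (a node may be both an input and an output node). The computation is a finite sequence of one-bit transmissions between nodes, the pattern of which (the directed communication multigraph, with one edge per transmitted bit) is fixed independently of the inputs; each transmitted bit is an arbitrary function of the input injected into the sending node (if any) and of the bits this node has received so far, and each output is an arbitrary function of the input injected into its output node (if any) and of all bits received there. The bit-meters $\beta$ of the circuit is the sum, over all edges of the multigraph, of the Euclidean distance between the two end nodes. An $(n,k)$ bit-meters decoder is such a circuit together with an encoding function $g:\{0,1\}^k\to\{0,1\}^n$. Its block error probability $P_{\mathrm e}$ on the binary erasure channel with erasure probability $\epsilon$ is the probability that the circuit's output differs from $m$, when $m$ is uniform on $\{0,1\}^k$ and the circuit's input in $\{0,1,\mathrm{e}\}^n$ is $g(m)$ with each position replaced by the erasure symbol $\mathrm{e}$ independently with probability $\epsilon$. **Theorem.** Let $0<\epsilon<1$. There are an integer $k_0$ and a real number $p_0>0$, depending only on $\epsilon$, such that every $(n,k)$ three-dimensional bit-meters decoder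 with $k\ge 1$ for the binary erasure channel with erasure probability $\epsilon$ which satisfies $k\ge k_0$ or $P_{\mathrm e}\le p_0$ has bit-meters $$\beta>\frac{27}{512}\left(\frac{\ln(4P_{\mathrm e})}{2\ln\epsilon}\right)^{1/3}k ,$$ where $(\cdot)^{1/3}$ is the real cube root (negative for negative arguments). In particular, in every sequence of decoders of increasing block length $n$ in which $k(n)\to\infty$ (for instance, in which the rate $k(n)/n$ is bounded away from $0$), or in which $k(n)\ge 1$ and $P_{\mathrm e}(n)\to 0$, the bound holds for all sufficiently large block lengths. -/

import Mathlib

namespace BitMeters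

/-- Locations of the computational nodes: the integer lattice `ℤ³`. -/
abbrev Node : Type := Fin 3 → ℤ

/-- The point of Euclidean three-space at which a node sits. -/
noncomputable def Node.pos (v : Node) : EuclideanSpace ℝ (Fin 3) :=
  WithLp.toLp 2 (fun i => (v i : ℝ))

/-- A symbol at the output of a binary erasure channel; `none` is the erasure symbol. -/
abbrev Symbol : Type := Option Bool

/-- One edge of the communication multigraph: a single bit sent from `src` to `dst`.
The bit may be any function of what the source knows at that moment: the channel symbol injected
into it (`none` if it is not an input node) and all the bits it has received so far, in
chronological order. -/
structure Transmission where
  src : Node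
  dst : Node
  msg : Option Symbol → List Bool → Bool

/-- The cost of an edge: the Euclidean distance between its end points. -/
noncomputable def Transmission.cost (e : Transmission) : ℝ :=
  dist e.src.pos e.dst.pos

/-- A three-dimensional bit-meters circuit with `n` inputs and `k` outputs. Every input node
receives one input, and a node may be an input and an output node at once. The communication
multigraph is the list `edges`, in chronological order; it is fixed in advance (it does not depend
on the inputs), and it may contain any number of edges between two given nodes. Output `j` is a
function of all that the node `outputNode j` knows at the end of the computation. -/
structure Circuit (n k : ℕ) where
  inputNode : Fin n → Node
  inputNode_injective : Function.Injective inputNode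
  outputNode : Fin k → Node
  edges : List Transmission
  out : Fin k → Option Symbol → List Bool → Bool

namespace Circuit

variable {n k : ℕ}

/-- The channel symbol injected into a node, `none` if the node is not an input node. -/
noncomputable def inputAt (c : Circuit n k) (y : Fin n → Symbol) : Node → Option Symbol :=
  Function.extend c.inputNode (fun i => some (y i)) (fun _ => none)

/-- The effect of one transmission on the lists of bits received so far at the nodes. -/
noncomputable def step (c : Circuit n k) (y : Fin n → Symbol) (r : Node → List Bool)
    (e : Transmission) : Node → List Bool :=
  Function.update r e.dst (r e.dst ++ [e.msg (c.inputAt y e.src) (r e.src)])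

/-- The bits received at each node in the whole computation on the input `y`. -/
noncomputable def received (c : Circuit n k) (y : Fin n → Symbol) : Node → List Bool :=
  c.edges.foldl (c.step y) (fun _ => [])

/-- The function that the circuit computes. -/
noncomputable def eval (c : Circuit n k) (y : Fin n → Symbol) : Fin k → Bool :=
  fun j => c.out j (c.inputAt y (c.outputNode j)) (c.received y (c.outputNode j))

/-- The energy (bit-meters) `β`: the sum of the costs of all edges of the multigraph. -/
noncomputable def bitMeters (c : Circuit n k) : ℝ :=
  (c.edges.map Transmission.cost).sum

end Circuit

/-- The output of the erasure channel on the input word `x` when exactly the positions in `E` are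
erased. -/
def erase {n : ℕ} (x : Fin n → Bool) (E : Finset (Fin n)) : Fin n → Symbol :=
  fun i => if i ∈ E then none else some (x i)

/-- The probability that exactly the positions in `E` are erased in `n` independent uses of the
binary erasure channel with erasure probability `ε`. -/
def erasureProb {n : ℕ} (ε : ℝ) (E : Finset (Fin n)) : ℝ :=
  ε ^ E.card * (1 - ε) ^ Eᶜ.card

/-- A three-dimensional bit-meters `(n, k)`-decoder: a circuit together with the encoding function
of the code it decodes. -/
structure Decoder (n k : ℕ) where
  circuit : Circuit n k
  encode : (Fin k → Bool) → (Fin n → Bool)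

open Classical in
/-- The block error probability: the `k` source bits `m` are independent and fair, the code word
`encode m` is sent over the binary erasure channel, and an error occurs if the decoder's estimate
differs from `m`. -/
noncomputable def Decoder.blockError {n k : ℕ} (D : Decoder n k) (ε : ℝ) : ℝ :=
  ∑ m : Fin k → Bool, (1 / 2 : ℝ) ^ k *
    ∑ E : Finset (Fin n), erasureProb ε E *
      (if D.circuit.eval (erase (D.encode m) E) = m then 0 else 1)

/-- The real cube root, also of negative numbers. -/
noncomputable def cubeRoot (x : ℝ) : ℝ :=
  (SignType.sign x : ℝ) * |x| ^ (1 / 3 : ℝ)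

theorem cubeRoot_pow_three (x : ℝ) : cubeRoot x ^ 3 = x := by
  have h : (|x| ^ (1 / 3 : ℝ)) ^ 3 = |x| := by
    rw [← Real.rpow_natCast, ← Real.rpow_mul (abs_nonneg x)]
    norm_num
  rw [cubeRoot, mul_pow, h]
  rcases lt_trichotomy x 0 with hx | hx | hx
  · simp [sign_neg hx, abs_of_neg hx]
    norm_num
  · simp [hx]
  · simp [sign_pos hx, abs_of_pos hx]

end BitMeters

/-! Suppose fewer bits enter a set `S` of nodes than outputs are produced in it. When all inputs in
`S` are erased, at most half of the messages are decoded correctly, so `ε ^ (number of inputs in S)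
≤ 2 * Pₑ` (`Decoder.pow_card_inputsIn_le`). A cube of side `s` holds at most `s ^ 3` inputs. Hence
if `2 * Pₑ < ε ^ s ^ 3`, every such cube, and every smaller one inside it, receives at least as many
bits as it produces outputs.

Tile space by cubes of side `s` and put concentric cubes of sides `s - 2 * j` into each. An edge of
length `d` enters at most `d` of them, so `β` is at least the number of pairs (output, nested cube
containing it). Averaged over the `s ^ 3` offsets of the tiling, an output lies in at least `s / 8`
nested cubes, so `β ≥ s * k / 8` (`Decoder.mul_le_bitMeters`). The choice of `s` is about the cube
root of `log (4 * Pₑ) / log ε`.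

If `Pₑ` is too large for `s ≥ 1` but at most `1 / 4`, single nodes serve as cuts and give `β ≥ k -
B` with `B` depending only on `ε` (`Decoder.sub_le_bitMeters`). For `Pₑ > 1 / 4` the claimed bound
is negative. -/

namespace BitMeters

/-! ### Information flow across cuts of a circuit. -/

namespace Circuit

variable {n k : ℕ}

open Classical in
/-- The number of edges that lead from outside of `S` into `S`. -/
noncomputable def entering (c : Circuit n k) (S : Set Node) : ℕ :=
  c.edges.countP (fun e => e.dst ∈ S ∧ e.src ∉ S)

open Classical in
/-- The outputs produced at the nodes of `S`. -/
noncomputable def outputsIn (c : Circuit n k) (S : Set Node) : Finset (Fin k) :=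
  {j | c.outputNode j ∈ S}

open Classical in
/-- The inputs injected into the nodes of `S`. -/
noncomputable def inputsIn (c : Circuit n k) (S : Set Node) : Finset (Fin n) :=
  {i | c.inputNode i ∈ S}

@[simp]
theorem mem_outputsIn (c : Circuit n k) (S : Set Node) (j : Fin k) :
    j ∈ c.outputsIn S ↔ c.outputNode j ∈ S := by
  simp [outputsIn]

@[simp]
theorem mem_inputsIn (c : Circuit n k) (S : Set Node) (i : Fin n) :
    i ∈ c.inputsIn S ↔ c.inputNode i ∈ S := by
  simp [inputsIn]

open Classical in
/-- The bits carried into `S` from outside by the transmissions in a list, when the computation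
starts from the lists `r` of received bits. -/
noncomputable def transcript (c : Circuit n k) (S : Set Node) (y : Fin n → Symbol) :
    List Transmission → (Node → List Bool) → List Bool
  | [], _ => []
  | e :: l, r =>
    (if e.dst ∈ S ∧ e.src ∉ S then [e.msg (c.inputAt y e.src) (r e.src)] else []) ++
      c.transcript S y l (c.step y r e)

open Classical in
theorem length_transcript (c : Circuit n k) (S : Set Node) (y : Fin n → Symbol)
    (l : List Transmission) (r : Node → List Bool) :
    (c.transcript S y l r).length = l.countP (fun e => e.dst ∈ S ∧ e.src ∉ S) := by
  induction l generalizing r with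
  | nil => simp [transcript]
  | cons e l ih =>
    rw [transcript, List.length_append, ih, List.countP_cons]
    by_cases h : e.dst ∈ S ∧ e.src ∉ S <;> simp [h, add_comm]

/-- What happens inside `S` is determined by the inputs in `S` and the bits that enter `S`. -/
theorem foldl_step_eq_of_transcript_eq (c : Circuit n k) (S : Set Node) (y y' : Fin n → Symbol)
    (hy : ∀ p ∈ S, c.inputAt y p = c.inputAt y' p) (l : List Transmission)
    (r r' : Node → List Bool) (hr : ∀ p ∈ S, r p = r' p)
    (ht : c.transcript S y l r = c.transcript S y' l r') :
    ∀ p ∈ S, l.foldl (c.step y) r p = l.foldl (c.step y') r' p := by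
  induction l generalizing r r' with
  | nil => simpa using hr
  | cons e l ih =>
    rw [transcript, transcript] at ht
    rw [List.foldl_cons, List.foldl_cons]
    obtain ⟨h1, h2⟩ := List.append_inj ht (by split_ifs <;> rfl)
    refine ih _ _ (fun p hp => ?_) h2
    rw [step, step]
    by_cases hpe : p = e.dst
    · subst hpe
      rw [Function.update_self, Function.update_self, hr _ hp]
      by_cases hs : e.src ∈ S
      · rw [hr _ hs, hy _ hs]
      · rw [if_pos ⟨hp, hs⟩, if_pos ⟨hp, hs⟩] at h1
        rw [h1]
    · rw [Function.update_of_ne hpe, Function.update_of_ne hpe, hr _ hp]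

theorem eval_eq_of_transcript_eq (c : Circuit n k) (S : Set Node) (y y' : Fin n → Symbol)
    (hy : ∀ i, c.inputNode i ∈ S → y i = y' i)
    (ht : c.transcript S y c.edges (fun _ => []) = c.transcript S y' c.edges (fun _ => []))
    (j : Fin k) (hj : c.outputNode j ∈ S) : c.eval y j = c.eval y' j := by
  have hin : ∀ p ∈ S, c.inputAt y p = c.inputAt y' p := by
    intro p hp
    by_cases h : ∃ i, c.inputNode i = p
    · obtain ⟨i, rfl⟩ := h
      simp [inputAt, c.inputNode_injective.extend_apply, hy i hp]
    · simp [inputAt, Function.extend_apply' _ _ _ h]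
  rw [eval, eval, hin _ hj, received, received,
    c.foldl_step_eq_of_transcript_eq S y y' hin c.edges _ _ (fun _ _ => rfl) ht _ hj]

/-- Double counting of pairs (edge, cut that it enters): by `h`, each edge is charged at most its
own length. -/
theorem sum_entering_le_bitMeters (c : Circuit n k) {ι : Type*} (F : Finset ι) (C : ι → Set Node)
    (h : ∀ p q : Node, ∀ G ⊆ F, (∀ i ∈ G, q ∈ C i ∧ p ∉ C i) → (G.card : ℝ) ≤ dist p.pos q.pos) :
    ∑ i ∈ F, (c.entering (C i) : ℝ) ≤ c.bitMeters := by
  classical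
  unfold entering bitMeters
  induction c.edges with
  | nil => simp
  | cons e l ih =>
    have h1 : ∀ i ∈ F, (((e :: l).countP (fun e => e.dst ∈ C i ∧ e.src ∉ C i) : ℕ) : ℝ) =
        (if e.dst ∈ C i ∧ e.src ∉ C i then 1 else 0) +
          (l.countP (fun e => e.dst ∈ C i ∧ e.src ∉ C i) : ℕ) := by
      intro i _
      rw [List.countP_cons]
      by_cases hi : e.dst ∈ C i ∧ e.src ∉ C i <;> simp [hi, add_comm]
    have h2 := h e.src e.dst (F.filter fun i => e.dst ∈ C i ∧ e.src ∉ C i)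
      (Finset.filter_subset _ _) (fun i hi => (Finset.mem_filter.1 hi).2)
    rw [Finset.natCast_card_filter] at h2
    rw [Finset.sum_congr rfl h1, Finset.sum_add_distrib, List.map_cons, List.sum_cons]
    exact add_le_add h2 ih

theorem bitMeters_nonneg (c : Circuit n k) : 0 ≤ c.bitMeters := by
  refine List.sum_nonneg fun x hx => ?_
  obtain ⟨e, -, rfl⟩ := List.mem_map.1 hx
  exact dist_nonneg

end Circuit

/-! ### Counting correctly decoded messages. -/

namespace Decoder

variable {n k : ℕ}

open Classical in
/-- The messages that are decoded correctly when exactly the positions in `E` are erased. -/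
noncomputable def correct (D : Decoder n k) (E : Finset (Fin n)) : Finset (Fin k → Bool) :=
  {m | D.circuit.eval (erase (D.encode m) E) = m}

/-- A correctly decoded message is recoverable from the bits entering `S`, the unerased code symbols
in `S`, and its own bits at the outputs outside `S`. -/
theorem card_correct_mul_le (D : Decoder n k) (E : Finset (Fin n)) (S : Set Node) :
    (D.correct E).card * 2 ^ (D.circuit.outputsIn S).card ≤
      2 ^ (D.circuit.entering S + (D.circuit.inputsIn S \ E).card + k) := by
  classical
  set c := D.circuit with hc
  let T : (Fin k → Bool) → List Bool := fun m =>
    c.transcript S (erase (D.encode m) E) c.edges (fun _ => [])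
  have hT : ∀ m, (T m).length = c.entering S := fun m => c.length_transcript S _ _ _
  let f : D.correct E → List.Vector Bool (c.entering S) ×
      ((↥(c.inputsIn S \ E)) → Bool) × (↥(c.outputsIn S)ᶜ → Bool) := fun m =>
    (⟨T m, hT m⟩, fun i => D.encode m i, fun j => m.1 j)
  have hf : Function.Injective f := by
    rintro ⟨m, hm⟩ ⟨m', hm'⟩ h
    have h1 : T m = T m' := congrArg (fun z => z.1.1) h
    have h2 := congrArg (fun z => z.2.1) h
    have h3 := congrArg (fun z => z.2.2) h
    simp only [correct, Finset.mem_filter, Finset.mem_univ, true_and] at hm hm'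
    ext j
    by_cases hj : c.outputNode j ∈ S
    · have := c.eval_eq_of_transcript_eq S (erase (D.encode m) E) (erase (D.encode m') E) ?_ h1 j hj
      · rwa [hm, hm'] at this
      · intro i hi
        by_cases hiE : i ∈ E
        · simp [erase, hiE]
        · simpa [erase, hiE] using congrFun h2 ⟨i, by simp [hi, hiE]⟩
    · exact congrFun h3 ⟨j, by simp [hj]⟩
  have hcard := Fintype.card_le_of_injective f hf
  simp only [Fintype.card_prod, Fintype.card_coe, card_vector, Fintype.card_bool,
    Fintype.card_fun] at hcard
  calc _ ≤ 2 ^ c.entering S * (2 ^ (c.inputsIn S \ E).card * 2 ^ (c.outputsIn S)ᶜ.card) *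
        2 ^ (c.outputsIn S).card := Nat.mul_le_mul_right _ hcard
    _ = 2 ^ (c.entering S + (c.inputsIn S \ E).card +
        ((c.outputsIn S)ᶜ.card + (c.outputsIn S).card)) := by ring
    _ = _ := by rw [Finset.card_compl_add_card, Fintype.card_fin]

theorem two_mul_card_correct_le (D : Decoder n k) (E : Finset (Fin n)) (S : Set Node)
    (h : D.circuit.entering S + (D.circuit.inputsIn S \ E).card < (D.circuit.outputsIn S).card) :
    2 * (D.correct E).card ≤ 2 ^ k := by
  set a := D.circuit.entering S + (D.circuit.inputsIn S \ E).card
  have h1 := D.card_correct_mul_le E S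
  have h2 : 2 ^ (a + 1) ≤ 2 ^ (D.circuit.outputsIn S).card := Nat.pow_le_pow_right two_pos h
  refine Nat.le_of_mul_le_mul_right (c := 2 ^ a) ?_ (by positivity)
  calc 2 * (D.correct E).card * 2 ^ a = (D.correct E).card * 2 ^ (a + 1) := by ring
    _ ≤ _ := Nat.mul_le_mul_left _ h2
    _ ≤ _ := h1
    _ = _ := by ring

end Decoder

/-! ### Probabilities of erasure patterns. -/

theorem erasureProb_nonneg {n : ℕ} {ε : ℝ} (h0 : 0 ≤ ε) (h1 : ε ≤ 1) (E : Finset (Fin n)) :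
    0 ≤ erasureProb ε E :=
  mul_nonneg (pow_nonneg h0 _) (pow_nonneg (sub_nonneg.2 h1) _)

theorem sum_prod_mul_prod_compl {n : ℕ} (f g : Fin n → ℝ) :
    ∑ E : Finset (Fin n), (∏ i ∈ E, f i) * ∏ i ∈ Eᶜ, g i = ∏ i, (f i + g i) := by
  rw [Finset.prod_add]
  simp [Finset.compl_eq_univ_sdiff]

theorem sum_erasureProb {n : ℕ} (ε : ℝ) : ∑ E : Finset (Fin n), erasureProb ε E = 1 := by
  simpa [erasureProb] using sum_prod_mul_prod_compl (n := n) (fun _ => ε) (fun _ => 1 - ε)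

theorem sum_erasureProb_superset {n : ℕ} (ε : ℝ) (I : Finset (Fin n)) :
    ∑ E with I ⊆ E, erasureProb ε E = ε ^ I.card := by
  -- Zero weight for "not erased" on `I` kills exactly the patterns that do not contain `I`.
  have h := sum_prod_mul_prod_compl (fun _ => ε) (fun i => if i ∈ I then 0 else 1 - ε)
  have h2 : ∏ i, (ε + if i ∈ I then 0 else 1 - ε) = ε ^ I.card := by
    rw [← Finset.prod_const, ← Finset.prod_subset (Finset.subset_univ I)]
    · exact Finset.prod_congr rfl fun i hi => by simp [hi]
    · intro i _ hi
      simp [hi]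
  rw [← h2, ← h, Finset.sum_filter]
  refine Finset.sum_congr rfl fun E _ => ?_
  split_ifs with hE
  · rw [erasureProb, Finset.prod_const]
    congr 1
    rw [← Finset.prod_const]
    refine Finset.prod_congr rfl fun i hi => ?_
    rw [if_neg fun h => Finset.mem_compl.1 hi (hE h)]
  · obtain ⟨i, hi, hiE⟩ := Finset.not_subset.1 hE
    rw [Finset.prod_eq_zero (i := i) (s := Eᶜ) (by simpa using hiE) (by simp [hi]), mul_zero]

theorem sum_erasureProb_disjoint {n : ℕ} (ε : ℝ) (I : Finset (Fin n)) :
    ∑ E with Disjoint I E, erasureProb ε E = (1 - ε) ^ I.card := by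
  have h := sum_prod_mul_prod_compl (fun i => if i ∈ I then 0 else ε) (fun _ => 1 - ε)
  have h2 : ∏ i, ((if i ∈ I then 0 else ε) + (1 - ε)) = (1 - ε) ^ I.card := by
    rw [← Finset.prod_const, ← Finset.prod_subset (Finset.subset_univ I)]
    · exact Finset.prod_congr rfl fun i hi => by simp [hi]
    · intro i _ hi
      simp [hi]
  rw [← h2, ← h, Finset.sum_filter]
  refine Finset.sum_congr rfl fun E _ => ?_
  split_ifs with hE
  · rw [erasureProb, Finset.prod_const]
    congr 1
    rw [← Finset.prod_const]
    refine Finset.prod_congr rfl fun i hi => ?_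
    rw [if_neg fun h => Finset.disjoint_left.1 hE h hi]
  · obtain ⟨i, hi, hiE⟩ := Finset.not_disjoint_iff.1 hE
    rw [Finset.prod_eq_zero (i := i) hiE (by simp [hi]), zero_mul]

/-! ### From cuts to the block error probability. -/

namespace Decoder

variable {n k : ℕ}

theorem blockError_eq (D : Decoder n k) (ε : ℝ) :
    D.blockError ε =
      ∑ E : Finset (Fin n), erasureProb ε E * (1 - (D.correct E).card / 2 ^ k) := by
  classical
  unfold blockError
  simp_rw [Finset.mul_sum]
  rw [Finset.sum_comm]
  refine Finset.sum_congr rfl fun E _ => ?_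
  have h : ∑ m : Fin k → Bool,
      (if D.circuit.eval (erase (D.encode m) E) = m then (0 : ℝ) else 1) =
        2 ^ k - (D.correct E).card := by
    have h1 : ∀ m : Fin k → Bool,
        (if D.circuit.eval (erase (D.encode m) E) = m then (0 : ℝ) else 1) =
          1 - if D.circuit.eval (erase (D.encode m) E) = m then (1 : ℝ) else 0 := by
      intro m
      split_ifs <;> norm_num
    simp_rw [h1, Finset.sum_sub_distrib]
    simp [correct]
  calc _ = (1 / 2 : ℝ) ^ k * erasureProb ε E * ∑ m : Fin k → Bool,
        (if D.circuit.eval (erase (D.encode m) E) = m then (0 : ℝ) else 1) := by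
        rw [Finset.mul_sum]
        refine Finset.sum_congr rfl fun m _ => ?_
        ring
    _ = _ := by
        rw [h, one_div, inv_pow]
        field_simp

/-- Each pattern in `𝓔` contributes at least half of its probability to the error. -/
theorem sum_le_two_mul_blockError (D : Decoder n k) {ε : ℝ} (h0 : 0 ≤ ε) (h1 : ε ≤ 1)
    (𝓔 : Finset (Finset (Fin n))) (h : ∀ E ∈ 𝓔, 2 * (D.correct E).card ≤ 2 ^ k) :
    ∑ E ∈ 𝓔, erasureProb ε E ≤ 2 * D.blockError ε := by
  classical
  have hk : (0 : ℝ) < 2 ^ k := by positivity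
  rw [blockError_eq, Finset.mul_sum]
  calc _ ≤ ∑ E ∈ 𝓔, 2 * (erasureProb ε E * (1 - (D.correct E).card / 2 ^ k)) := by
        refine Finset.sum_le_sum fun E hE => ?_
        have h2 : (2 * (D.correct E).card : ℝ) ≤ 2 ^ k := by exact_mod_cast h E hE
        have h3 : ((D.correct E).card : ℝ) / 2 ^ k ≤ 1 / 2 := by
          rw [div_le_iff₀ hk]; linarith
        nlinarith [erasureProb_nonneg h0 h1 E]
    _ ≤ _ := by
        refine Finset.sum_le_sum_of_subset_of_nonneg (Finset.subset_univ _) fun E _ _ => ?_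
        have h2 : ((D.correct E).card : ℝ) ≤ 2 ^ k := by
          have := Finset.card_le_univ (D.correct E)
          simp only [Fintype.card_fun, Fintype.card_bool, Fintype.card_fin] at this
          exact_mod_cast this
        have h3 : ((D.correct E).card : ℝ) / 2 ^ k ≤ 1 := by
          rw [div_le_one hk]; exact h2
        have := erasureProb_nonneg h0 h1 E
        have := mul_nonneg this (sub_nonneg.2 h3)
        linarith

theorem pow_card_inputsIn_le (D : Decoder n k) {ε : ℝ} (h0 : 0 ≤ ε) (h1 : ε ≤ 1) (S : Set Node)
    (h : D.circuit.entering S < (D.circuit.outputsIn S).card) :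
    ε ^ (D.circuit.inputsIn S).card ≤ 2 * D.blockError ε := by
  rw [← sum_erasureProb_superset]
  refine D.sum_le_two_mul_blockError h0 h1 _ fun E hE => ?_
  refine D.two_mul_card_correct_le E S ?_
  rw [Finset.mem_filter] at hE
  rwa [Finset.sdiff_eq_empty_iff_subset.2 hE.2, Finset.card_empty, add_zero]

theorem blockError_pos (D : Decoder n k) {ε : ℝ} (h0 : 0 < ε) (h1 : ε ≤ 1) (hk : 0 < k) :
    0 < D.blockError ε := by
  -- Nothing enters the whole space, which produces `k > 0` outputs.
  have h := D.pow_card_inputsIn_le h0.le h1 Set.univ (by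
    simpa [Circuit.entering, Circuit.outputsIn] using hk)
  have := pow_pos h0 (D.circuit.inputsIn Set.univ).card
  linarith

end Decoder

end BitMeters

/-! ### Nested cubes and averaging over the grid offset. -/

namespace BitMeters

theorem abs_sub_le_floor_dist (p q : Node) (i : Fin 3) :
    |p i - q i| ≤ (⌊dist p.pos q.pos⌋₊ : ℤ) := by
  have h : ((|p i - q i| : ℤ) : ℝ) ≤ dist p.pos q.pos := by
    rw [dist_eq_norm]
    simpa [Node.pos] using PiLp.norm_apply_le (p.pos - q.pos) i
  have h2 : (|p i - q i|.toNat : ℤ) = |p i - q i| := Int.toNat_of_nonneg (abs_nonneg _)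
  rw [← h2]
  have : |p i - q i|.toNat ≤ ⌊dist p.pos q.pos⌋₊ := by
    refine Nat.le_floor ?_
    rw [← h2] at h
    exact_mod_cast h
  exact_mod_cast this

/-- The cubes of side `s - 2 * j` concentric with the cubes of side `s` of a cubic grid with offset
`a`. The grid cube meant has the integer coordinates `q`. -/
def nestedCube (s : ℕ) (a q : Node) (j : ℕ) : Set Node :=
  {p | ∀ i, s * q i + j ≤ p i + a i ∧ p i + a i + j < s * q i + s}

/-- The coordinates of the grid cube that contains a node. -/
def gridCell (s : ℕ) (a p : Node) : Node := fun i => (p i + a i) / s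

theorem gridCell_eq_of_mem {s : ℕ} {a q p : Node} {j : ℕ} (h : p ∈ nestedCube s a q j) :
    gridCell s a p = q := by
  funext i
  obtain ⟨h1, h2⟩ := h i
  have hs : (0 : ℤ) < s := by omega
  refine le_antisymm ?_ ?_
  · refine Int.lt_add_one_iff.1 ((Int.ediv_lt_iff_lt_mul hs).2 ?_)
    linarith
  · refine (Int.le_ediv_iff_mul_le hs).2 ?_
    linarith

theorem mem_nestedCube_gridCell {s : ℕ} {a p : Node} {j : ℕ} :
    p ∈ nestedCube s a (gridCell s a p) j ↔
      ∀ i, j ≤ (p i + a i) % s ∧ (p i + a i) % s + j < s := by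
  refine forall_congr' fun i => ?_
  have := Int.mul_ediv_add_emod (p i + a i) s
  simp only [gridCell]
  constructor <;> rintro ⟨h1, h2⟩ <;> constructor <;> linarith

theorem card_inputsIn_nestedCube_le {n k : ℕ} (c : Circuit n k) (s : ℕ) (a q : Node) (j : ℕ) :
    (c.inputsIn (nestedCube s a q j)).card ≤ s ^ 3 := by
  have h : (c.inputsIn (nestedCube s a q j)).card ≤
      (Fintype.piFinset fun i : Fin 3 => Finset.Ico (s * q i - a i) (s * q i - a i + s)).card := by
    refine Finset.card_le_card_of_injOn c.inputNode ?_ c.inputNode_injective.injOn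
    intro i hi
    have hi' : c.inputNode i ∈ nestedCube s a q j := by simpa using hi
    simp only [Finset.mem_coe, Fintype.mem_piFinset, Finset.mem_Ico]
    intro t
    obtain ⟨h1, h2⟩ := hi' t
    constructor <;> linarith
  simpa using h

/-- A transmission from `p` to `q` enters at most as many nested cubes as it is long. -/
theorem card_nestedCube_le_dist (s : ℕ) (a p q : Node) (G : Finset (Node × ℕ))
    (hG : ∀ x ∈ G, q ∈ nestedCube s a x.1 x.2 ∧ p ∉ nestedCube s a x.1 x.2) :
    (G.card : ℝ) ≤ dist p.pos q.pos := by
  refine le_trans ?_ (Nat.floor_le dist_nonneg)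
  rw [Nat.cast_le]
  set d := ⌊dist p.pos q.pos⌋₊
  rcases G.eq_empty_or_nonempty with rfl | hne
  · simp
  obtain ⟨y, hy, hmin⟩ := G.exists_min_image Prod.snd hne
  have hcell : ∀ x ∈ G, x.1 = gridCell s a q := fun x hx => (gridCell_eq_of_mem (hG x hx).1).symm
  have hsub : ∀ x ∈ G, x.2 ∈ Finset.Ico y.2 (y.2 + d) := by
    intro x hx
    rw [Finset.mem_Ico]
    refine ⟨hmin x hx, ?_⟩
    by_contra! hlt
    -- `q` lies at depth at least `y.2 + d` in the cell and no coordinate of `p` is further than `d`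
    -- from that of `q`, so `p` would lie in the cube of index `y.2`.
    refine (hG y hy).2 fun i => ?_
    obtain ⟨h1, h2⟩ := (hG x hx).1 i
    rw [hcell x hx, ← hcell y hy] at h1 h2
    have h3 := abs_le.1 (abs_sub_le_floor_dist p q i)
    have h4 : ((y.2 + d : ℕ) : ℤ) ≤ x.2 := by exact_mod_cast hlt
    push_cast at h4
    constructor <;> linarith [h3.1, h3.2]
  have hcard := Finset.card_le_card_of_injOn Prod.snd hsub (by
    intro x hx z hz hxz
    exact Prod.ext ((hcell x hx).trans (hcell z hz).symm) hxz)
  simpa using hcard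

theorem sub_le_card_residues (s j : ℕ) (z : ℤ) :
    s - 2 * j ≤ ((Finset.Ico (0 : ℤ) s).filter
      fun a => j ≤ (z + a) % s ∧ (z + a) % s + j < s).card := by
  have h : (Finset.Ico (j : ℤ) (s - j)).card ≤ ((Finset.Ico (0 : ℤ) s).filter
      fun a => j ≤ (z + a) % s ∧ (z + a) % s + j < s).card := by
    -- Each admissible residue `r` is reached by the offset `(r - z) % s`.
    have hmod : ∀ r ∈ Finset.Ico (j : ℤ) (s - j), (z + (r - z) % s) % s = r := by
      intro r hr
      rw [Finset.mem_Ico] at hr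
      rw [Int.add_emod_emod, add_sub_cancel]
      exact Int.emod_eq_of_lt (by omega) (by omega)
    refine Finset.card_le_card_of_injOn (fun r => (r - z) % s) ?_ ?_
    · intro r hr
      have h1 := hmod r hr
      have hr' := Finset.mem_Ico.1 hr
      have hs : (0 : ℤ) < s := by omega
      simp only [Finset.coe_filter, Finset.mem_Ico, Set.mem_ofPred_eq]
      rw [h1]
      exact ⟨⟨Int.emod_nonneg _ hs.ne', Int.emod_lt_of_pos _ hs⟩, hr'.1, by linarith [hr'.2]⟩
    · intro r hr r' hr' heq
      rw [← hmod r hr, ← hmod r' hr']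
      simp only at heq
      rw [heq]
  rw [Int.card_Ico] at h
  omega

/-- The offsets of the cubic grid of side `s`. -/
noncomputable def offsets (s : ℕ) : Finset Node := Fintype.piFinset fun _ => Finset.Ico (0 : ℤ) s

theorem card_offsets (s : ℕ) : (offsets s).card = s ^ 3 := by
  simp [offsets]

open Classical in
theorem pow_le_card_offsets_filter (s j : ℕ) (p : Node) :
    (s - 2 * j) ^ 3 ≤
      ((offsets s).filter fun a => p ∈ nestedCube s a (gridCell s a p) j).card := by
  have h : (offsets s).filter (fun a => p ∈ nestedCube s a (gridCell s a p) j) =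
      Fintype.piFinset fun i => (Finset.Ico (0 : ℤ) s).filter
        fun a => j ≤ (p i + a) % s ∧ (p i + a) % s + j < s := by
    ext a
    simp only [offsets, Finset.mem_filter, Fintype.mem_piFinset, mem_nestedCube_gridCell,
      forall_and]
  rw [h, Fintype.card_piFinset]
  calc (s - 2 * j) ^ 3 = ∏ _i : Fin 3, (s - 2 * j) := by simp
    _ ≤ _ := Finset.prod_le_prod' fun i _ => sub_le_card_residues s j (p i)

/-- Truncated subtraction makes the terms with `2 * j ≥ s` vanish. Passing from `s` to `s + 2` adds
only the term `(s + 2) ^ 3`, and `(s + 2) ^ 4 ≤ s ^ 4 + 8 * (s + 2) ^ 3`. -/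
theorem pow_four_le_sum (s : ℕ) : s ^ 4 ≤ 8 * ∑ j ∈ Finset.range s, (s - 2 * j) ^ 3 := by
  induction s using Nat.strong_induction_on with
  | _ s ih =>
    match s with
    | 0 => simp
    | 1 => simp
    | s + 2 =>
      have h := ih s (by omega)
      have h1 : ∑ j ∈ Finset.range (s + 2), (s + 2 - 2 * j) ^ 3 =
          ∑ j ∈ Finset.range s, (s - 2 * j) ^ 3 + (s + 2) ^ 3 := by
        rw [Finset.sum_range_succ', Finset.sum_range_succ]
        have h2 : s + 2 - 2 * (s + 1) = 0 := by omega
        rw [h2]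
        have h3 : ∀ j, s + 2 - 2 * (j + 1) = s - 2 * j := fun j => by omega
        simp [h3]
      rw [h1]
      nlinarith [Nat.zero_le (s ^ 2), Nat.zero_le (s ^ 3)]

/-- If every cut by a nested cube is entered by at least as many bits as there are outputs in it,
then on average a bit travels over a fixed fraction of the side length. -/
theorem Circuit.mul_le_bitMeters {n k : ℕ} (c : Circuit n k) (s : ℕ) (hs : 0 < s)
    (h : ∀ a q j, (c.outputsIn (nestedCube s a q j)).card ≤ c.entering (nestedCube s a q j)) :
    (s : ℝ) / 8 * k ≤ c.bitMeters := by
  classical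
  have h1 : ∀ a : Node, ((∑ o : Fin k, ∑ j ∈ Finset.range s,
      if c.outputNode o ∈ nestedCube s a (gridCell s a (c.outputNode o)) j then 1 else 0 : ℕ) : ℝ)
        ≤ c.bitMeters := by
    intro a
    -- Only the finitely many cells that contain outputs matter.
    let Q : Finset Node := Finset.univ.image fun o => gridCell s a (c.outputNode o)
    have hb := c.sum_entering_le_bitMeters (Q ×ˢ Finset.range s)
      (fun x => nestedCube s a x.1 x.2) fun p q G _ hG => card_nestedCube_le_dist s a p q G hG
    refine le_trans ?_ hb
    rw [← Nat.cast_sum, Nat.cast_le]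
    calc _ ≤ ∑ o : Fin k, ∑ x ∈ Q ×ˢ Finset.range s,
          (if c.outputNode o ∈ nestedCube s a x.1 x.2 then 1 else 0) := by
          refine Finset.sum_le_sum fun o _ => ?_
          rw [Finset.sum_product]
          exact Finset.single_le_sum (f := fun q => ∑ j ∈ Finset.range s,
            if c.outputNode o ∈ nestedCube s a q j then 1 else 0) (fun _ _ => Nat.zero_le _)
            (Finset.mem_image_of_mem _ (Finset.mem_univ o))
      _ = ∑ x ∈ Q ×ˢ Finset.range s, (c.outputsIn (nestedCube s a x.1 x.2)).card := by
          rw [Finset.sum_comm]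
          refine Finset.sum_congr rfl fun x _ => ?_
          rw [Circuit.outputsIn, Finset.card_filter]
      _ ≤ _ := Finset.sum_le_sum fun x _ => h a x.1 x.2
  -- For each output, at least `(s - 2 * j) ^ 3` offsets place it in the cube of index `j` of its
  -- cell.
  have h2 : k * s ^ 4 ≤ 8 * ∑ a ∈ offsets s, ∑ o : Fin k, ∑ j ∈ Finset.range s,
      if c.outputNode o ∈ nestedCube s a (gridCell s a (c.outputNode o)) j then 1 else 0 := by
    rw [Finset.sum_comm, Finset.mul_sum]
    calc k * s ^ 4 = ∑ _o : Fin k, s ^ 4 := by simp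
      _ ≤ _ := by
        refine Finset.sum_le_sum fun o _ => (pow_four_le_sum s).trans ?_
        rw [Finset.sum_comm]
        refine Nat.mul_le_mul_left _ (Finset.sum_le_sum fun j _ => ?_)
        rw [← Finset.card_filter]
        exact pow_le_card_offsets_filter s j _
  have h3 := Finset.sum_le_sum fun a (_ : a ∈ offsets s) => h1 a
  rw [Finset.sum_const, card_offsets, nsmul_eq_mul, ← Nat.cast_sum] at h3
  have h4 : (k * s ^ 4 : ℝ) ≤ 8 * ((∑ a ∈ offsets s, ∑ o : Fin k, ∑ j ∈ Finset.range s,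
      if c.outputNode o ∈ nestedCube s a (gridCell s a (c.outputNode o)) j then 1 else 0 : ℕ) : ℝ)
      := by exact_mod_cast h2
  have hs3 : (0 : ℝ) < (s : ℝ) ^ 3 := by positivity
  push_cast at h3 h4
  refine le_of_mul_le_mul_left ?_ hs3
  have h5 : (s : ℝ) ^ 3 * (s / 8 * k) = k * s ^ 4 / 8 := by ring
  linarith

/-! ### Lower bounds on the bit-meters, from cubes and from single nodes. -/

namespace Decoder

variable {n k : ℕ}

theorem mul_le_bitMeters (D : Decoder n k) {ε : ℝ} (h0 : 0 ≤ ε) (h1 : ε ≤ 1) (s : ℕ) (hs : 0 < s)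
    (h : 2 * D.blockError ε < ε ^ s ^ 3) : (s : ℝ) / 8 * k ≤ D.circuit.bitMeters := by
  refine D.circuit.mul_le_bitMeters s hs fun a q j => ?_
  by_contra! hlt
  have h2 := D.pow_card_inputsIn_le h0 h1 _ hlt
  have h3 := pow_le_pow_of_le_one h0 h1 (card_inputsIn_nestedCube_le D.circuit s a q j)
  linarith

/-- If fewer bits enter a node than outputs are produced there, then the node is an input node. -/
theorem exists_inputNode_of_entering_lt (D : Decoder n k) {ε : ℝ} (h0 : 0 ≤ ε) (h1 : ε ≤ 1)
    (he : D.blockError ε < 1 / 2) (p : Node)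
    (h : D.circuit.entering {p} < (D.circuit.outputsIn {p}).card) :
    ∃ i, D.circuit.inputNode i = p := by
  by_contra! hp
  have h2 := D.pow_card_inputsIn_le h0 h1 _ h
  have h3 : D.circuit.inputsIn {p} = ∅ := by
    ext i
    simp [hp i]
  rw [h3] at h2
  norm_num at h2
  linarith

/-- A node holds at most one input, worth at most one bit of message; a larger deficit would spoil
half of the messages under every erasure pattern. -/
theorem card_outputsIn_singleton_le (D : Decoder n k) {ε : ℝ} (h0 : 0 ≤ ε) (h1 : ε ≤ 1)
    (he : D.blockError ε < 1 / 2) (p : Node) :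
    (D.circuit.outputsIn {p}).card ≤ D.circuit.entering {p} + 1 := by
  by_contra! hlt
  have h2 := D.sum_le_two_mul_blockError h0 h1 Finset.univ fun E _ => by
    refine D.two_mul_card_correct_le E {p} (lt_of_le_of_lt ?_ hlt)
    refine Nat.add_le_add_left (Finset.card_le_one.2 fun i hi i' hi' => ?_) _
    simp only [Finset.mem_sdiff, Circuit.mem_inputsIn, Set.mem_singleton_iff] at hi hi'
    exact D.circuit.inputNode_injective (hi.1.trans hi'.1.symm)
  rw [sum_erasureProb] at h2
  linarith

/-- An edge enters at most one singleton, and only if its ends are distinct lattice points, hence at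
distance at least 1. -/
theorem sum_entering_singleton_le (D : Decoder n k) (F : Finset Node) :
    ∑ p ∈ F, (D.circuit.entering {p} : ℝ) ≤ D.circuit.bitMeters := by
  refine D.circuit.sum_entering_le_bitMeters F (fun p => {p}) fun p q G _ hG => ?_
  rcases G.eq_empty_or_nonempty with rfl | ⟨x, hx⟩
  · simp
  have hx' := hG x hx
  have hne : p ≠ q := fun h => hx'.2 (h ▸ hx'.1)
  have hcard : G.card ≤ 1 := Finset.card_le_one.2 fun u hu v hv =>
    ((hG u hu).1 : q = u).symm.trans (hG v hv).1
  obtain ⟨i, hi⟩ := Function.ne_iff.1 hne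
  have h1 := abs_sub_le_floor_dist p q i
  have h2 : 1 ≤ |p i - q i| := Int.one_le_abs (sub_ne_zero.2 hi)
  have h3 : 1 ≤ ⌊dist p.pos q.pos⌋₊ := by exact_mod_cast h2.trans h1
  exact (Nat.cast_le.2 (hcard.trans h3)).trans (Nat.floor_le dist_nonneg)

/-- An input node producing more outputs than it receives bits fails whenever its input is erased.
With `B` such nodes, some input among them would be erased with probability above `1 / 2`, forcing
error above `1 / 4`. So fewer than `B` nodes have a deficit, each of one output. -/
theorem sub_le_bitMeters (D : Decoder n k) {ε : ℝ} (h0 : 0 ≤ ε) (h1 : ε ≤ 1)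
    (he : D.blockError ε ≤ 1 / 4) (B : ℕ) (hB : (1 - ε) ^ B < 1 / 2) :
    (k : ℝ) - B ≤ D.circuit.bitMeters := by
  classical
  have he' : D.blockError ε < 1 / 2 := by linarith
  set c := D.circuit with hc
  let bad : Finset (Fin n) :=
    {i | c.entering {c.inputNode i} < (c.outputsIn {c.inputNode i}).card}
  have hbad : bad.card < B := by
    by_contra! hlt
    have h2 := D.sum_le_two_mul_blockError h0 h1 (Finset.univ.filter fun E => ¬ Disjoint bad E)
      fun E hE => by
        obtain ⟨i, hi, hiE⟩ := Finset.not_disjoint_iff.1 (Finset.mem_filter.1 hE).2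
        refine D.two_mul_card_correct_le E {c.inputNode i} ?_
        have h3 : c.inputsIn {c.inputNode i} \ E = ∅ := by
          rw [Finset.sdiff_eq_empty_iff_subset]
          intro i' hi'
          have : c.inputNode i' = c.inputNode i := by simpa using hi'
          rwa [c.inputNode_injective this]
        rw [← hc, h3, Finset.card_empty, add_zero]
        exact (Finset.mem_filter.1 hi).2
    have h3 := Finset.sum_filter_add_sum_filter_not Finset.univ
      (fun E : Finset (Fin n) => Disjoint bad E) (erasureProb ε)
    rw [sum_erasureProb, sum_erasureProb_disjoint] at h3
    have h4 := pow_le_pow_of_le_one (sub_nonneg.2 h1) (by linarith : 1 - ε ≤ 1) hlt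
    linarith
  let F : Finset Node := Finset.univ.image c.outputNode
  have hk : k = ∑ p ∈ F, (c.outputsIn {p}).card := by
    have := Finset.card_eq_sum_card_image c.outputNode Finset.univ
    rw [Finset.card_fin] at this
    simpa [F, Circuit.outputsIn] using this
  have hp : ∀ p ∈ F, (c.outputsIn {p}).card ≤
      c.entering {p} + if p ∈ bad.image c.inputNode then 1 else 0 := by
    intro p _
    split_ifs with hpb
    · exact D.card_outputsIn_singleton_le h0 h1 he' p
    · by_contra! hlt
      obtain ⟨i, rfl⟩ := D.exists_inputNode_of_entering_lt h0 h1 he' p hlt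
      exact hpb (Finset.mem_image_of_mem _ (Finset.mem_filter.2 ⟨Finset.mem_univ _, hlt⟩))
  have hsum : k ≤ ∑ p ∈ F, c.entering {p} + bad.card := by
    calc k = _ := hk
      _ ≤ _ := Finset.sum_le_sum hp
      _ = ∑ p ∈ F, c.entering {p} + (F.filter (· ∈ bad.image c.inputNode)).card := by
        rw [Finset.sum_add_distrib, Finset.card_filter]
      _ ≤ _ := Nat.add_le_add_left ((Finset.card_le_card fun p hp =>
          (Finset.mem_filter.1 hp).2).trans Finset.card_image_le) _
  have h5 := D.sum_entering_singleton_le F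
  have h6 : (k : ℝ) ≤ ∑ p ∈ F, (c.entering {p} : ℝ) + bad.card := by exact_mod_cast hsum
  have h7 : (bad.card : ℝ) ≤ B := by exact_mod_cast hbad.le
  linarith

end Decoder

/-! ### Cube roots and the choice of the side length. -/

theorem cubeRoot_lt_of_lt_pow {x y : ℝ} (hy : 0 ≤ y) (h : x < y ^ 3) : cubeRoot x < y := by
  refine lt_of_pow_lt_pow_left₀ 3 hy ?_
  rwa [cubeRoot_pow_three]

theorem exists_pow_three_le_lt {x : ℝ} (hx : 1 ≤ x) :
    ∃ s : ℕ, 0 < s ∧ (s : ℝ) ^ 3 ≤ x ∧ x < ((s : ℝ) + 1) ^ 3 := by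
  have hc : 1 ≤ cubeRoot x := by
    by_contra! h
    have h2 := cubeRoot_pow_three x
    nlinarith [sq_nonneg (cubeRoot x), sq_nonneg (cubeRoot x + 1)]
  refine ⟨⌊cubeRoot x⌋₊, Nat.floor_pos.2 hc, ?_, ?_⟩
  · exact (pow_le_pow_left₀ (Nat.cast_nonneg _) (Nat.floor_le (by linarith)) 3).trans_eq
      (cubeRoot_pow_three x)
  · calc x = cubeRoot x ^ 3 := (cubeRoot_pow_three x).symm
      _ < _ := pow_lt_pow_left₀ (Nat.lt_floor_add_one _) (by linarith) (by norm_num)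

end BitMeters

theorem mainTheorem2 (ε : ℝ) (hε0 : 0 < ε) (hε1 : ε < 1) :
    ∃ k₀ : ℕ, ∃ p₀ : ℝ, 0 < p₀ ∧
      ∀ (n k : ℕ) (D : BitMeters.Decoder n k), 0 < k →
        (k₀ ≤ k ∨ D.blockError ε ≤ p₀) →
          27 / 512 * BitMeters.cubeRoot
              (Real.log (4 * D.blockError ε) / (2 * Real.log ε)) * (k : ℝ)
            < D.circuit.bitMeters := by
  obtain ⟨B, hB⟩ := exists_pow_lt_of_lt_one (by norm_num : (0 : ℝ) < 1 / 2)
    (by linarith : 1 - ε < 1)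
  -- `k ≥ 2 * B` turns `k - B` into at least `k / 2`; `P ≤ ε / 4` is what makes `2 * x ≥ 1`, so that
  -- a side `s ≥ 1` exists.
  refine ⟨2 * B, ε / 4, by positivity, fun n k D hk h => ?_⟩
  have hP := D.blockError_pos hε0 hε1.le hk
  have hβ := D.circuit.bitMeters_nonneg
  have hlog : Real.log ε < 0 := Real.log_neg hε0 hε1
  have hk' : (0 : ℝ) < k := by exact_mod_cast hk
  set P := D.blockError ε with hPdef
  set x := Real.log (4 * P) / (2 * Real.log ε) with hx
  have hxlog : Real.log (4 * P) = 2 * x * Real.log ε := by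
    have hne := hlog.ne
    rw [hx]
    field_simp
  rcases lt_or_ge (1 / 4) P with hP4 | hP4
  · have hneg : x < 0 := div_neg_of_pos_of_neg (Real.log_pos (by linarith)) (by linarith)
    have hc : BitMeters.cubeRoot x < 0 := by
      refine BitMeters.cubeRoot_lt_of_lt_pow le_rfl ?_
      simpa using hneg
    nlinarith [mul_neg_of_neg_of_pos hc hk']
  rcases le_or_gt P (ε / 4) with hPε | hPε
  · have hx1 : 1 ≤ 2 * x := by
      have h1 : Real.log (4 * P) ≤ Real.log ε := Real.log_le_log (by linarith) (by linarith)
      by_contra! hlt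
      nlinarith
    obtain ⟨s, hs, hs1, hs2⟩ := BitMeters.exists_pow_three_le_lt hx1
    have hs' : (1 : ℝ) ≤ s := by exact_mod_cast hs
    have hpow : 4 * P ≤ ε ^ s ^ 3 := by
      rw [← Real.log_le_log_iff (by linarith) (by positivity), Real.log_pow, hxlog]
      push_cast
      exact mul_le_mul_of_nonpos_right hs1 hlog.le
    have hb := D.mul_le_bitMeters hε0.le hε1.le s hs (by linarith)
    -- `64 / 27` is `1 / 8` divided by `27 / 512`; rounding costs at most `s + 1 ≤ 2 * s`.
    have hc : BitMeters.cubeRoot x < 64 / 27 * s := by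
      refine BitMeters.cubeRoot_lt_of_lt_pow (by positivity) ?_
      have h1 : ((s : ℝ) + 1) ^ 3 ≤ (2 * s) ^ 3 :=
        pow_le_pow_left₀ (by positivity) (by linarith) 3
      have h2 : (0 : ℝ) < (s : ℝ) ^ 3 := by positivity
      calc x < (2 * s : ℝ) ^ 3 / 2 := by linarith
        _ = 4 * (s : ℝ) ^ 3 := by ring
        _ < (64 / 27) ^ 3 * (s : ℝ) ^ 3 := by nlinarith
        _ = _ := by ring
    refine lt_of_lt_of_le ?_ hb
    refine mul_lt_mul_of_pos_right ?_ hk'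
    linarith
  · have hkB : (2 * B : ℝ) ≤ k := by
      rcases h with h | h
      · exact_mod_cast h
      · exact absurd h (not_le.2 hPε)
    have hx1 : 2 * x < 1 := by
      have h1 : Real.log ε < Real.log (4 * P) := Real.log_lt_log hε0 (by linarith)
      by_contra! hlt
      nlinarith
    have hc : BitMeters.cubeRoot x < 1 := BitMeters.cubeRoot_lt_of_lt_pow zero_le_one (by linarith)
    have hb := D.sub_le_bitMeters hε0.le hε1.le hP4 B hB
    have := mul_lt_mul_of_pos_right hc hk'
    linarith
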